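/- Consider a network polymatrix game: a finite set $\mathcal N$ of players, each player $k$ with a finite non-empty set $S_k$ of actions and mixed strategies $\Delta_k=\{\mathbf x_k\in\mathbb R^{S_k}: x_{ki}\ge 0,\ \sum_i x_{ki}=1\}$, an undirected graph $(\mathcal N,\mathcal E)$ without loops, and for every edge $(k,l)\in\mathcal E$ payoff matrices $A^{kl}\in\mathbb R^{S_k\times S_l}$ and $A^{lk}\in\mathbb R^{S_l\times S_k}$. Player $k$ receives the payoff $u_k(\mathbf x)=\sum_{l:(k,l)\in\mathcal E}\mathbf x_k\cdot A^{kl}\mathbf x_l$, and $r_{ki}(\mathbf x_{-k})=\partial u_k/\partial x_{ki}=\sum_{l:(k,l)\in\mathcal E}(A^{kl}\mathbf x_l)_i$. Let $T_k$, $k\in\mathcal N$, be exploration rates. A quantal response equilibrium (QRE) is a joint strategy $\bar{\mathbf x}\in\Delta=\prod_k\Delta_k$ with $$\bar x_{ki}=\frac{\exp(r_{ki}(\bar{\mathbf x}_{-k})/T_k)}{\sum_{j\in S_k}\exp(r_{kj}(\bar{\mathbf x}_{-k})/T_k)}\qquad\text{for all }k\in\mathcal N,\ i\in S_k,$$ and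 the Q-Learning dynamics are the system of ordinary differential equations $$\frac{\dot x_{ki}}{x_{ki}}=r_{ki}(\mathbf x_{-k})-\langle\mathbf x_k,r_k(\mathbf x_{-k})\rangle+T_k\sum_{j\in S_k}x_{kj}\ln\frac{x_{kj}}{x_{ki}}$$ on the set of $\mathbf x\in\Delta$ all of whose coordinates are positive. Suppose that the game is pairwise zero-sum, i.e. $A^{kl}+(A^{lk})^\top=0$ for all $(k,l)\in\mathcal E$, and that $T_k>0$ for every player $k$. Then the Q-Learning dynamics converge to a unique QRE: there is exactly one QRE $\bar{\mathbf x}$, from every $\mathbf x(0)\in\Delta$ with all coordinates positive there starts a solution defined for all $t\ge 0$, and every solution $\mathbf x(t)$ defined for all $t\ge 0$ satisfies $\mathbf x(t)\to\bar{\mathbf x}$ as $t\to\infty$. -/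

import Mathlib

open Filter Topology

/-- A network polymatrix game with finite player set `N` and action sets `S k`: an undirected
loopless graph on the players, with a payoff matrix `A k l` for each ordered pair of players.
Only the matrices of pairs joined by an edge ever enter the game. -/
structure NetworkGame (N : Type*) (S : N → Type*) where
  /-- the interaction network -/
  graph : SimpleGraph N
  /-- `A k l` is the payoff matrix of player `k` against player `l` -/
  A : ∀ k l : N, Matrix (S k) (S l) ℝ

namespace NetworkGame

variable {N : Type*} [Fintype N] {S : N → Type*} [∀ k, Fintype (S k)]

/-- The joint mixed strategies: each player has a probability vector on her actions. -/
def strategies (S : N → Type*) [∀ k, Fintype (S k)] : Set (∀ k, S k → ℝ) :=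
  {x | ∀ k, x k ∈ stdSimplex ℝ (S k)}

/-- The joint mixed strategies in which every action of every player has positive probability. -/
def interiorStrategies (S : N → Type*) [∀ k, Fintype (S k)] : Set (∀ k, S k → ℝ) :=
  {x | x ∈ strategies S ∧ ∀ k i, 0 < x k i}

open Classical in
/-- The payoff `u_k(x) = ∑_{l : (k, l) an edge} x_k ⬝ A^{kl} x_l`. -/
noncomputable def payoff (G : NetworkGame N S) (k : N) (x : ∀ k, S k → ℝ) : ℝ :=
  ∑ l with G.graph.Adj k l, x k ⬝ᵥ (G.A k l).mulVec (x l)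

open Classical in
/-- The reward `r_{ki}(x_{-k})` of player `k` for the action `i`; it is the partial derivative of
`u_k` in the coordinate `x_{ki}`, see `hasDerivAt_payoff`. -/
noncomputable def reward (G : NetworkGame N S) (x : ∀ k, S k → ℝ) (k : N) (i : S k) : ℝ :=
  ∑ l with G.graph.Adj k l, (G.A k l).mulVec (x l) i

theorem payoff_eq_dotProduct_reward (G : NetworkGame N S) (k : N) (x : ∀ k, S k → ℝ) :
    G.payoff k x = x k ⬝ᵥ G.reward x k := by
  classical
  simp only [payoff, reward, dotProduct, Finset.mul_sum]
  exact Finset.sum_comm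

open Classical in
theorem reward_update (G : NetworkGame N S) (k : N) (x : ∀ k, S k → ℝ) (y : S k → ℝ) :
    G.reward (Function.update x k y) k = G.reward x k := by
  funext i
  refine Finset.sum_congr rfl fun l hl => ?_
  have hne : l ≠ k := (Finset.mem_filter.1 hl).2.ne'
  rw [Function.update_of_ne hne]

open Classical in
/-- `r_{ki} = ∂ u_k / ∂ x_{ki}`. -/
theorem hasDerivAt_payoff (G : NetworkGame N S) (k : N) (i : S k) (x : ∀ k, S k → ℝ) :
    HasDerivAt (fun s : ℝ => G.payoff k (Function.update x k (Function.update (x k) i s)))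
      (G.reward x k i) (x k i) := by
  simp only [payoff_eq_dotProduct_reward, reward_update, Function.update_self]
  have h : ∀ s : ℝ, Function.update (x k) i s ⬝ᵥ G.reward x k
      = s * G.reward x k i + ∑ j ∈ Finset.univ.erase i, x k j * G.reward x k j := by
    intro s
    rw [dotProduct, ← Finset.add_sum_erase _ _ (Finset.mem_univ i)]
    refine congrArg₂ _ (by simp) (Finset.sum_congr rfl fun j hj => ?_)
    rw [Function.update_of_ne (Finset.ne_of_mem_erase hj)]
  simp only [h]
  simpa using ((hasDerivAt_id (x k i)).mul_const (G.reward x k i)).add_const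
    (∑ j ∈ Finset.univ.erase i, x k j * G.reward x k j)

/-- The game is pairwise zero-sum: `A^{kl} + (A^{lk})ᵀ = 0` on every edge. -/
def IsPairwiseZeroSum (G : NetworkGame N S) : Prop :=
  ∀ k l, G.graph.Adj k l → G.A k l + (G.A l k).transpose = 0

/-- `x` is a quantal response equilibrium for the exploration rates `T`. -/
def IsQRE (G : NetworkGame N S) (T : N → ℝ) (x : ∀ k, S k → ℝ) : Prop :=
  x ∈ strategies S ∧ ∀ k i,
    x k i = Real.exp (G.reward x k i / T k) / ∑ j, Real.exp (G.reward x k j / T k)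

/-- The right-hand side of the Q-Learning dynamics, i.e. the prescribed value of the logarithmic
derivative of `x_{ki}`:
`r_{ki}(x_{-k}) - ⟨x_k, r_k(x)⟩ + T_k ∑_j x_{kj} ln (x_{kj} / x_{ki})`. -/
noncomputable def qldRate (G : NetworkGame N S) (T : N → ℝ) (x : ∀ k, S k → ℝ)
    (k : N) (i : S k) : ℝ :=
  G.reward x k i - x k ⬝ᵥ G.reward x k + T k * ∑ j, x k j * Real.log (x k j / x k i)

/-- `x` is a trajectory of the Q-Learning dynamics on `[0, ∞)`: it takes values in the interior
strategies, which is where the logarithmic derivatives and the logarithms in the equation make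
sense, and it satisfies `(d/dt x_{ki}) / x_{ki} = qldRate` (one-sided derivative at `0`). -/
def IsQLDTrajectory (G : NetworkGame N S) (T : N → ℝ) (x : ℝ → ∀ k, S k → ℝ) : Prop :=
  ∀ t, 0 ≤ t → x t ∈ interiorStrategies S ∧
    ∀ k i, HasDerivWithinAt (fun s => x s k i) (x t k i * G.qldRate T (x t) k i) (Set.Ici 0) t

end NetworkGame

/-!
A weighted relative entropy drives both the existence of the equilibrium and the convergence to it.
Write `B x y = ∑ k, ⟨x k, r k (y)⟩` (`NetworkGame.pairing`). A pairwise zero-sum game makes `B`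
skew-symmetric, so that `B d d = 0`: in every argument below the rewards cancel, and only entropy
terms remain.

*Existence of an equilibrium* (`NetworkGame.IsPairwiseZeroSum.exists_isQRE`). No fixed point theorem
is needed. Let `q` be the quantal response to `x`. By skew-symmetry, `∑ k, T k * KL (x k ‖ q k)` is
the convex function `NetworkGame.potential`, which has a minimiser `x` on the compact set of joint
strategies. Moving from `x` towards `q` has, at the interior points of the segment, a nonnegative
directional derivative; as these points tend to `x`, this forces `x = q` coordinate by coordinate.
As the estimate is made at interior points, a minimiser on the boundary needs no
separate treatment.

*Trajectories* (`NetworkGame.exists_isQLDTrajectory`). In the scores `u` with `x k = softmax (u k)`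
the Q-Learning dynamics become `u' = r (x) - T u`, a smooth field of linear growth on a vector
space, whose solutions are global.

*Convergence* (`NetworkGame.IsQLDTrajectory.tendsto`). For an equilibrium `p`, the derivative of
`V = ∑ k, KL (p k ‖ x k)` along a trajectory is
`-∑ k, T k * ∑ i, (p k i - x k i) * (log (p k i) - log (x k i))`, which is at most `-c * V` for
`c ≤ min T`. So `V` decays exponentially, and it dominates `∑ (√p - √x) ^ 2`.

*Uniqueness* follows, an equilibrium being a constant trajectory.
-/

/-! ### Global solutions of differential equations of linear growth -/

/-- A vector field of class `C^1` and of linear growth has solutions for all times: by the growth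
bound, the time for which the Picard-Lindelöf theorem yields a solution does not depend on the
starting point. -/
theorem exists_hasDerivAt_of_contDiff_of_norm_le {E : Type*} [NormedAddCommGroup E]
    [NormedSpace ℝ E] [FiniteDimensional ℝ E] {F : E → E} (hF : ContDiff ℝ 1 F) {R C : ℝ}
    (hR : 0 ≤ R) (hC : 0 ≤ C) (hRC : ∀ u, ‖F u‖ ≤ R + C * ‖u‖) (u₀ : E) :
    ∃ γ : ℝ → E, γ 0 = u₀ ∧ ∀ t, HasDerivAt γ (F (γ t)) t := by
  have := FiniteDimensional.complete ℝ E
  have := FiniteDimensional.proper ℝ E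
  set ε : ℝ := 1 / (1 + 2 * C) with hε
  have hε0 : 0 < ε := by positivity
  have hloc : ∀ u : E, ∃ γ : ℝ → E, γ 0 = u ∧
      ∀ t ∈ Set.Icc (-ε) ε, HasDerivWithinAt γ (F (γ t)) (Set.Icc (-ε) ε) t := by
    intro u
    -- The ball of radius `R + ‖u‖ + 1` is so large that the speed in it allows the time `ε`.
    set a : NNReal := ⟨R + ‖u‖ + 1, by positivity⟩ with ha
    have haR : (a : ℝ) = R + ‖u‖ + 1 := rfl
    set L : NNReal := ⟨(1 + 2 * C) * a, by positivity⟩ with hL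
    have hLR : (L : ℝ) = (1 + 2 * C) * a := rfl
    obtain ⟨K, hK⟩ := ((hF.locallyLipschitz).locallyLipschitzOn
      (s := Metric.closedBall u a)).exists_lipschitzOnWith_of_compact (isCompact_closedBall u a)
    have hpl : IsPicardLindelof (fun _ => F) (tmin := -ε) (tmax := ε)
        ⟨0, by constructor <;> linarith⟩ u a 0 L K := by
      refine IsPicardLindelof.of_time_independent (fun v hv => ?_) hK ?_
      · have hv' : ‖v‖ ≤ ‖u‖ + a := by
          rw [mem_closedBall_iff_norm] at hv
          calc ‖v‖ = ‖u + (v - u)‖ := by abel_nf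
            _ ≤ ‖u‖ + ‖v - u‖ := norm_add_le _ _
            _ ≤ ‖u‖ + a := by linarith
        have h2 : ‖u‖ ≤ a := by rw [haR]; linarith
        have h3 : C * ‖v‖ ≤ C * (2 * a) := mul_le_mul_of_nonneg_left (by linarith) hC
        have h4 : R ≤ a := by rw [haR]; linarith [norm_nonneg u]
        rw [hLR]
        linarith [hRC v]
      · simp only [sub_zero, zero_sub, neg_neg, max_self, NNReal.coe_zero, hLR]
        rw [hε]
        field_simp
        rfl
    exact hpl.exists_eq_forall_mem_Icc_hasDerivWithinAt₀
  obtain ⟨γ, h0, hγ⟩ := exists_isMIntegralCurve_of_isMIntegralCurveOn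
    (I := modelWithCornersSelf ℝ E) (v := F)
    (contMDiff_vectorSpace_iff_contDiff.2 hF) hε0 (fun u => by
      obtain ⟨γ, h0, hγ⟩ := hloc u
      refine ⟨γ, h0, fun t ht => ?_⟩
      exact ((hγ t (Set.Ioo_subset_Icc_self ht)).mono
        Set.Ioo_subset_Icc_self).hasFDerivWithinAt.hasMFDerivWithinAt) u₀
  have hd : ∀ t, HasFDerivAt γ ((1 : ℝ →L[ℝ] ℝ).smulRight (F (γ t))) t :=
    fun t => hasMFDerivAt_iff_hasFDerivAt.1 (hγ t)
  exact ⟨γ, h0, fun t => by simpa using (hd t).hasDerivAt⟩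

namespace NetworkGame

/-! ### Inequalities for the logarithm -/

section Logarithm

/-- The tangent inequality for `x ↦ x * log x`, valid also at the boundary point `0`. -/
theorem mul_log_sub_mul_log_le {a b : ℝ} (ha : 0 ≤ a) (hb : 0 < b) :
    b * Real.log b - a * Real.log a ≤ (1 + Real.log b) * (b - a) := by
  rcases ha.eq_or_lt with rfl | ha
  · simp only [zero_mul, sub_zero]
    nlinarith
  · have h1 := Real.log_le_sub_one_of_pos (div_pos hb ha)
    rw [Real.log_div hb.ne' ha.ne'] at h1
    have h2 := mul_le_mul_of_nonneg_left h1 ha.le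
    have h3 : a * (b / a - 1) = b - a := by field_simp
    linarith

theorem log_sub_log_mul_sub_pos {a b : ℝ} (ha : 0 < a) (hb : 0 < b) (hab : a ≠ b) :
    0 < (Real.log b - Real.log a) * (b - a) := by
  rcases lt_or_gt_of_ne hab with h | h
  · exact mul_pos (sub_pos.2 (Real.log_lt_log ha h)) (sub_pos.2 h)
  · exact mul_pos_of_neg_of_neg (sub_neg.2 (Real.log_lt_log hb h)) (sub_neg.2 h)

/-- On the segment from `a` to `b`, the number `(log b - log ·) * (b - a)` decreases; the logarithm
is evaluated only at interior points, so that `a = 0` is allowed. -/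
theorem log_segment_antitone {a b s s' : ℝ} (ha : 0 ≤ a) (hb : 0 < b) (hs : 0 < s) (hss' : s ≤ s')
    (hs' : s' ≤ 1) :
    (Real.log b - Real.log (a + s' * (b - a))) * (b - a)
      ≤ (Real.log b - Real.log (a + s * (b - a))) * (b - a) := by
  have hpos : ∀ r, 0 < r → r ≤ 1 → 0 < a + r * (b - a) := fun r h0 h1 => by
    nlinarith [mul_pos h0 hb, mul_nonneg (sub_nonneg.2 h1) ha]
  rcases le_total a b with h | h
  · have := Real.log_le_log (hpos s hs (hss'.trans hs'))
      (by nlinarith : a + s * (b - a) ≤ a + s' * (b - a))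
    exact mul_le_mul_of_nonneg_right (by linarith) (sub_nonneg.2 h)
  · have := Real.log_le_log (hpos s' (hs.trans_le hss') hs')
      (by nlinarith : a + s' * (b - a) ≤ a + s * (b - a))
    exact mul_le_mul_of_nonpos_right (by linarith) (sub_nonpos.2 h)

end Logarithm

section Gibbs

variable {ι : Type*} [Fintype ι] {p q : ι → ℝ}

/-- Gibbs' inequality. -/
theorem sum_mul_log_sub_log_nonneg (hp : ∀ i, 0 < p i) (hq : ∀ i, 0 < q i)
    (hpq : ∑ i, p i = ∑ i, q i) : 0 ≤ ∑ i, p i * (Real.log (p i) - Real.log (q i)) := by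
  have h : ∀ i, p i - q i ≤ p i * (Real.log (p i) - Real.log (q i)) := fun i => by
    have h1 := Real.log_le_sub_one_of_pos (div_pos (hq i) (hp i))
    rw [Real.log_div (hq i).ne' (hp i).ne'] at h1
    have h2 := mul_le_mul_of_nonneg_left h1 (hp i).le
    have h3 : p i * (q i / p i - 1) = q i - p i := by
      have := (hp i).ne'
      field_simp
    linarith
  calc (0 : ℝ) = ∑ i, (p i - q i) := by rw [Finset.sum_sub_distrib, hpq, sub_self]
    _ ≤ _ := Finset.sum_le_sum fun i _ => h i

/-- The relative entropy dominates the squared Hellinger distance. -/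
theorem sum_sqrt_sub_sqrt_sq_le (hp : ∀ i, 0 < p i) (hq : ∀ i, 0 < q i)
    (hpq : ∑ i, p i = ∑ i, q i) :
    ∑ i, (√(p i) - √(q i)) ^ 2 ≤ ∑ i, p i * (Real.log (p i) - Real.log (q i)) := by
  have h : ∀ i, (√(p i) - √(q i)) ^ 2 + (p i - q i)
      ≤ p i * (Real.log (p i) - Real.log (q i)) := fun i => by
    have hsp := Real.sqrt_pos.2 (hp i)
    have hsq := Real.sqrt_pos.2 (hq i)
    have h1 := Real.log_le_sub_one_of_pos (div_pos hsq hsp)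
    rw [Real.log_div hsq.ne' hsp.ne', Real.log_sqrt (hq i).le, Real.log_sqrt (hp i).le] at h1
    have h2 := mul_le_mul_of_nonneg_left h1 (hp i).le
    have hp2 := Real.sq_sqrt (hp i).le
    have hq2 := Real.sq_sqrt (hq i).le
    have h3 : p i * (√(q i) / √(p i) - 1) = √(p i) * √(q i) - p i := by
      nth_rewrite 1 [← hp2]
      field_simp
      rw [mul_sub, Real.mul_self_sqrt (hp i).le]
    nlinarith
  calc ∑ i, (√(p i) - √(q i)) ^ 2
      = ∑ i, ((√(p i) - √(q i)) ^ 2 + (p i - q i)) := by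
        rw [Finset.sum_add_distrib, Finset.sum_sub_distrib, hpq, sub_self, add_zero]
    _ ≤ _ := Finset.sum_le_sum fun i _ => h i

end Gibbs

/-! ### Softmax and log-sum-exp -/

section Softmax

variable {ι : Type*} [Fintype ι]

/-- The softmax vector of the scores `u`: the probabilities proportional to `exp (u i)`. -/
noncomputable def softmax (u : ι → ℝ) (i : ι) : ℝ :=
  Real.exp (u i) / ∑ j, Real.exp (u j)

/-- The log-sum-exp function `log ∑ i, exp (u i)`, whose gradient is `softmax`. -/
noncomputable def logSumExp (u : ι → ℝ) : ℝ :=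
  Real.log (∑ j, Real.exp (u j))

theorem softmax_log {x : ι → ℝ} (hx : ∀ i, 0 < x i) (hs : ∑ i, x i = 1) :
    softmax (fun i => Real.log (x i)) = x := by
  funext i
  simp only [softmax, Real.exp_log (hx _), hs, div_one]

variable [Nonempty ι]

theorem sum_exp_pos (u : ι → ℝ) : 0 < ∑ j, Real.exp (u j) :=
  Finset.sum_pos (fun _ _ => Real.exp_pos _) Finset.univ_nonempty

theorem softmax_pos (u : ι → ℝ) (i : ι) : 0 < softmax u i :=
  div_pos (Real.exp_pos _) (sum_exp_pos u)

theorem sum_softmax (u : ι → ℝ) : ∑ i, softmax u i = 1 := by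
  simp only [softmax, ← Finset.sum_div]
  exact div_self (sum_exp_pos u).ne'

theorem softmax_mem_stdSimplex (u : ι → ℝ) : softmax u ∈ stdSimplex ℝ ι :=
  ⟨fun i => (softmax_pos u i).le, sum_softmax u⟩

theorem log_softmax (u : ι → ℝ) (i : ι) : Real.log (softmax u i) = u i - logSumExp u := by
  rw [softmax, Real.log_div (Real.exp_pos _).ne' (sum_exp_pos u).ne', Real.log_exp, logSumExp]

theorem contDiff_softmax {n : WithTop ℕ∞} : ContDiff ℝ n (softmax : (ι → ℝ) → ι → ℝ) := by
  refine contDiff_pi.2 fun i => ContDiff.div ?_ ?_ fun u => (sum_exp_pos u).ne'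
  · exact (contDiff_apply ℝ ℝ i).exp
  · exact ContDiff.sum fun j _ => (contDiff_apply ℝ ℝ j).exp

theorem continuous_logSumExp : Continuous (logSumExp : (ι → ℝ) → ℝ) :=
  Continuous.log (by fun_prop) fun u => (sum_exp_pos u).ne'

/-- The chain rule for `softmax`, in logarithmic form: the relative rate of change of a
probability is the excess of its score's rate over the mean rate. -/
theorem hasDerivAt_softmax_comp {u : ℝ → ι → ℝ} {u' : ι → ℝ} {t : ℝ} (hu : HasDerivAt u u' t)
    (i : ι) :
    HasDerivAt (fun s => softmax (u s) i)
      (softmax (u t) i * (u' i - ∑ j, softmax (u t) j * u' j)) t := by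
  have hu' : ∀ j, HasDerivAt (fun s => u s j) (u' j) t := hasDerivAt_pi.1 hu
  have h := (hu' i).exp.fun_div (HasDerivAt.fun_sum fun j (_ : j ∈ Finset.univ) => (hu' j).exp)
    (sum_exp_pos (u t)).ne'
  refine h.congr_deriv ?_
  have hZ := (sum_exp_pos (u t)).ne'
  have hm : ∑ j, softmax (u t) j * u' j
      = (∑ j, Real.exp (u t j) * u' j) / ∑ j, Real.exp (u t j) := by
    rw [Finset.sum_div]
    exact Finset.sum_congr rfl fun j _ => by rw [softmax]; ring
  rw [hm, softmax]
  field_simp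

/-- The tangent inequality for the convex function `logSumExp`. -/
theorem logSumExp_sub_le (u v : ι → ℝ) :
    logSumExp u - logSumExp v ≤ ∑ i, softmax u i * (u i - v i) := by
  have h := sum_mul_log_sub_log_nonneg (softmax_pos u) (softmax_pos v)
    ((sum_softmax u).trans (sum_softmax v).symm)
  simp only [log_softmax] at h
  have h2 : ∑ i, softmax u i * (u i - logSumExp u - (v i - logSumExp v))
      = ∑ i, softmax u i * (u i - v i) - (logSumExp u - logSumExp v) * ∑ i, softmax u i := by
    rw [Finset.mul_sum, ← Finset.sum_sub_distrib]
    exact Finset.sum_congr rfl fun i _ => by ring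
  rw [h2, sum_softmax] at h
  linarith

end Softmax

/-! ### The strategy space -/

section Strategies

variable {N : Type*} {S : N → Type*} [∀ k, Fintype (S k)]

theorem isCompact_strategies : IsCompact (strategies S) := by
  have : strategies S = Set.univ.pi fun k => stdSimplex ℝ (S k) := by
    ext x; simp [strategies]
  rw [this]
  exact isCompact_univ_pi fun k => isCompact_stdSimplex ℝ (S k)

theorem softmax_mem_interiorStrategies [∀ k, Nonempty (S k)] (u : ∀ k, S k → ℝ) :
    (fun k => softmax (u k)) ∈ interiorStrategies S :=
  ⟨fun k => softmax_mem_stdSimplex (u k), fun k i => softmax_pos (u k) i⟩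

end Strategies

variable {N : Type*} [Fintype N] {S : N → Type*} [∀ k, Fintype (S k)]

/-! ### The payoff pairing of a zero-sum game -/

section Pairing

theorem reward_sub (G : NetworkGame N S) (x y : ∀ k, S k → ℝ) (k : N) :
    G.reward (x - y) k = G.reward x k - G.reward y k := by
  funext i
  simp only [reward, Pi.sub_apply, Matrix.mulVec_sub, Finset.sum_sub_distrib]

theorem reward_smul (G : NetworkGame N S) (c : ℝ) (x : ∀ k, S k → ℝ) (k : N) :
    G.reward (c • x) k = c • G.reward x k := by
  funext i
  simp only [reward, Pi.smul_apply, Matrix.mulVec_smul, Finset.smul_sum]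

theorem contDiff_reward (G : NetworkGame N S) {n : WithTop ℕ∞} (k : N) (i : S k) :
    ContDiff ℝ n fun x : ∀ k, S k → ℝ => G.reward x k i := by
  simp only [reward, Matrix.mulVec, dotProduct]
  exact ContDiff.sum fun l _ => ContDiff.sum fun j _ =>
    contDiff_const.mul (contDiff_pi.1 (contDiff_pi.1 contDiff_id l) j)

theorem continuous_reward (G : NetworkGame N S) (k : N) (i : S k) :
    Continuous fun x : ∀ k, S k → ℝ => G.reward x k i :=
  (G.contDiff_reward (n := 0) k i).continuous

/-- The total payoff of all players when player `k` uses `x k` against the others' `y`. -/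
noncomputable def pairing (G : NetworkGame N S) (x y : ∀ k, S k → ℝ) : ℝ :=
  ∑ k, x k ⬝ᵥ G.reward y k

theorem pairing_sub_right (G : NetworkGame N S) (x y z : ∀ k, S k → ℝ) :
    G.pairing x (y - z) = G.pairing x y - G.pairing x z := by
  simp only [pairing, reward_sub, dotProduct_sub, Finset.sum_sub_distrib]

theorem pairing_smul_right (G : NetworkGame N S) (c : ℝ) (x y : ∀ k, S k → ℝ) :
    G.pairing x (c • y) = c * G.pairing x y := by
  simp only [pairing, reward_smul, dotProduct_smul, smul_eq_mul, Finset.mul_sum]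

theorem IsPairwiseZeroSum.pairing_comm {G : NetworkGame N S} (hG : G.IsPairwiseZeroSum)
    (x y : ∀ k, S k → ℝ) : G.pairing x y = -G.pairing y x := by
  classical
  have hexp : ∀ x y : ∀ k, S k → ℝ, G.pairing x y
      = ∑ k, ∑ l, if G.graph.Adj k l then x k ⬝ᵥ (G.A k l).mulVec (y l) else 0 := fun x y => by
    refine Finset.sum_congr rfl fun k _ => ?_
    rw [← Finset.sum_filter]
    simp only [reward, dotProduct, Finset.mul_sum]
    rw [Finset.sum_comm]
  rw [hexp, hexp, Finset.sum_comm, ← Finset.sum_neg_distrib]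
  refine Finset.sum_congr rfl fun k _ => ?_
  rw [← Finset.sum_neg_distrib]
  refine Finset.sum_congr rfl fun l _ => ?_
  by_cases h : G.graph.Adj k l
  · rw [if_pos h, if_pos h.symm, eq_neg_of_add_eq_zero_left (hG l k h.symm), Matrix.neg_mulVec,
      dotProduct_neg, Matrix.mulVec_transpose, dotProduct_comm, ← Matrix.dotProduct_mulVec]
  · rw [if_neg h, if_neg fun h' => h h'.symm, neg_zero]

theorem IsPairwiseZeroSum.pairing_self {G : NetworkGame N S} (hG : G.IsPairwiseZeroSum)
    (x : ∀ k, S k → ℝ) : G.pairing x x = 0 := by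
  linarith [hG.pairing_comm x x]

end Pairing

/-! ### Existence of a quantal response equilibrium -/

section Existence

/-- The quantal response: each player's softmax reply to the rewards at `x`. -/
noncomputable def response (G : NetworkGame N S) (T : N → ℝ) (x : ∀ k, S k → ℝ) :
    ∀ k, S k → ℝ :=
  fun k => softmax fun i => G.reward x k i / T k

/-- The potential `∑ k, T k * (∑ i, x k i * log (x k i) + logSumExp (r k (x) / T k))`. In a
pairwise zero-sum game, at a joint strategy `x`, it is the weighted relative entropy
`∑ k, T k * KL (x k ‖ q k)` of `x` with respect to the quantal response `q` to `x`, because the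
mixed terms `⟨x k, r k (x)⟩` sum to `0`. -/
noncomputable def potential (G : NetworkGame N S) (T : N → ℝ) (x : ∀ k, S k → ℝ) : ℝ :=
  ∑ k, T k * (∑ i, x k i * Real.log (x k i) + logSumExp fun i => G.reward x k i / T k)

variable [∀ k, Nonempty (S k)]

theorem isQRE_iff {G : NetworkGame N S} {T : N → ℝ} {x : ∀ k, S k → ℝ} :
    G.IsQRE T x ↔ x = G.response T x := by
  constructor
  · intro h
    funext k i
    exact h.2 k i
  · intro h
    refine ⟨fun k => ?_, fun k i => congrFun (congrFun h k) i⟩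
    rw [h]
    exact softmax_mem_stdSimplex _

theorem continuous_response (G : NetworkGame N S) (T : N → ℝ) : Continuous (G.response T) :=
  continuous_pi fun k => (contDiff_softmax (n := 0)).continuous.comp <|
    continuous_pi fun i => (G.continuous_reward k i).div_const _

theorem continuous_potential (G : NetworkGame N S) (T : N → ℝ) : Continuous (G.potential T) := by
  refine continuous_finsetSum _ fun k _ => continuous_const.mul (Continuous.add ?_ ?_)
  · exact continuous_finsetSum _ fun i _ => Real.continuous_mul_log.comp
      (by fun_prop)
  · exact continuous_logSumExp.comp <|
      continuous_pi fun i => (G.continuous_reward k i).div_const _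

/-- The tangent inequality at `y` for the convex function `potential`. -/
theorem potential_sub_le {G : NetworkGame N S} {T : N → ℝ} (hT : ∀ k, 0 < T k)
    {x y : ∀ k, S k → ℝ} (hx : ∀ k i, 0 ≤ x k i) (hy : ∀ k i, 0 < y k i)
    (hxy : ∀ k, ∑ i, y k i = ∑ i, x k i) :
    G.potential T y - G.potential T x
      ≤ ∑ k, T k * ∑ i, Real.log (y k i) * (y k i - x k i)
        + G.pairing (G.response T y) (y - x) := by
  rw [potential, potential, pairing, ← Finset.sum_sub_distrib, ← Finset.sum_add_distrib]
  refine Finset.sum_le_sum fun k _ => ?_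
  have h1 : ∑ i, y k i * Real.log (y k i) - ∑ i, x k i * Real.log (x k i)
      ≤ ∑ i, Real.log (y k i) * (y k i - x k i) := by
    rw [← Finset.sum_sub_distrib]
    calc _ ≤ ∑ i, (1 + Real.log (y k i)) * (y k i - x k i) :=
          Finset.sum_le_sum fun i _ => mul_log_sub_mul_log_le (hx k i) (hy k i)
      _ = ∑ i, Real.log (y k i) * (y k i - x k i) := by
          simp only [add_mul, one_mul, Finset.sum_add_distrib, Finset.sum_sub_distrib, hxy k,
            sub_self, zero_add]
  have h2 := logSumExp_sub_le (fun i => G.reward y k i / T k) (fun i => G.reward x k i / T k)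
  have h3 : G.response T y k ⬝ᵥ G.reward (y - x) k = T k * ∑ i,
      softmax (fun i => G.reward y k i / T k) i * (G.reward y k i / T k - G.reward x k i / T k) := by
    rw [dotProduct, Finset.mul_sum, reward_sub]
    refine Finset.sum_congr rfl fun i _ => ?_
    have := (hT k).ne'
    simp only [response, Pi.sub_apply]
    field_simp
  rw [h3, ← mul_sub, ← mul_add]
  exact mul_le_mul_of_nonneg_left (by linarith) (hT k).le

theorem sum_mul_log_response {G : NetworkGame N S} {T : N → ℝ} (hT : ∀ k, 0 < T k)
    (x : ∀ k, S k → ℝ) {d : ∀ k, S k → ℝ} (hd : ∀ k, ∑ i, d k i = 0) :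
    ∑ k, T k * ∑ i, Real.log (G.response T x k i) * d k i = G.pairing d x := by
  refine Finset.sum_congr rfl fun k _ => ?_
  have := (hT k).ne'
  simp only [response, log_softmax, sub_mul, Finset.sum_sub_distrib, ← Finset.mul_sum, hd k,
    mul_zero, sub_zero, dotProduct]
  rw [Finset.mul_sum]
  exact Finset.sum_congr rfl fun i _ => by field_simp

/-- A minimiser of `potential` is a quantal response equilibrium: otherwise `potential` would
decrease along the segment from the minimiser to its quantal response. -/
theorem IsPairwiseZeroSum.exists_isQRE {G : NetworkGame N S} (hG : G.IsPairwiseZeroSum) {T : N → ℝ}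
    (hT : ∀ k, 0 < T k) : ∃ x, G.IsQRE T x := by
  have hne : (strategies S).Nonempty :=
    ⟨fun k => softmax 0, fun k => softmax_mem_stdSimplex _⟩
  obtain ⟨x, hx, hmin⟩ := isCompact_strategies.exists_isMinOn hne
    (G.continuous_potential T).continuousOn
  refine ⟨x, isQRE_iff.2 ?_⟩
  set q := G.response T x with hq
  have hq0 : ∀ k i, 0 < q k i := fun k i => softmax_pos _ i
  have hd : ∀ k, ∑ i, (q - x) k i = 0 := fun k => by
    simp only [Pi.sub_apply, Finset.sum_sub_distrib, (hx k).2]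
    rw [hq, response, sum_softmax, sub_self]
  by_contra hxq
  obtain ⟨k₀, i₀, hki⟩ : ∃ k i, x k i ≠ q k i := by
    by_contra! h
    exact hxq (funext fun k => funext fun i => h k i)
  set z : ℝ → ∀ k, S k → ℝ := fun s => x + s • (q - x) with hz
  have hz0 : ∀ s, 0 < s → s ≤ 1 → ∀ k i, 0 < z s k i := fun s h0 h1 k i => by
    have h : z s k i = (1 - s) * x k i + s * q k i := by
      simp only [hz, Pi.add_apply, Pi.smul_apply, Pi.sub_apply, smul_eq_mul]; ring
    rw [h]
    exact add_pos_of_nonneg_of_pos (mul_nonneg (by linarith) ((hx k).1 i)) (mul_pos h0 (hq0 k i))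
  have hzsum : ∀ s k, ∑ i, z s k i = ∑ i, x k i := fun s k => by
    simp only [hz, Pi.add_apply, Pi.smul_apply, smul_eq_mul, Finset.sum_add_distrib,
      ← Finset.mul_sum, hd k, mul_zero, add_zero]
  -- First-order condition at the interior point `z s`, divided by `s`.
  have hfirst : ∀ s, 0 < s → s ≤ 1 →
      0 ≤ ∑ k, T k * ∑ i, Real.log (z s k i) * (q - x) k i
        + G.pairing (G.response T (z s)) (q - x) := fun s h0 h1 => by
    have hzs : z s ∈ strategies S := fun k =>
      ⟨fun i => (hz0 s h0 h1 k i).le, (hzsum s k).trans (hx k).2⟩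
    have h := (sub_nonneg.2 (hmin hzs)).trans
      (potential_sub_le hT (fun k i => (hx k).1 i) (hz0 s h0 h1) (hzsum s))
    have hzx : z s - x = s • (q - x) := by simp only [hz, add_sub_cancel_left]
    have hlin : ∑ k, T k * ∑ i, Real.log (z s k i) * (z s k i - x k i)
        = s * ∑ k, T k * ∑ i, Real.log (z s k i) * (q - x) k i := by
      simp only [Finset.mul_sum]
      refine Finset.sum_congr rfl fun k _ => Finset.sum_congr rfl fun i _ => ?_
      have : z s k i - x k i = s * (q - x) k i := congrFun (congrFun hzx k) i
      rw [this]; ring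
    rw [hzx, pairing_smul_right, hlin, ← mul_add] at h
    exact nonneg_of_mul_nonneg_right h h0
  have hskew : G.pairing (q - x) x = -G.pairing q (q - x) := by
    have h1 := hG.pairing_comm q (q - x)
    have h2 := hG.pairing_self (q - x)
    rw [pairing_sub_right] at h2
    linarith
  -- The amount by which the log-terms at `q` exceed those at `z s` vanishes as `s → 0`,
  -- although it is bounded below by a positive constant.
  have hup : ∀ s, 0 < s → s ≤ 1 / 2 →
      T k₀ * ((Real.log (q k₀ i₀) - Real.log (z (1 / 2) k₀ i₀)) * (q k₀ i₀ - x k₀ i₀))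
        ≤ G.pairing (G.response T (z s)) (q - x) - G.pairing q (q - x) := fun s h0 h1 => by
    have hsum : ∑ k, T k * ∑ i, (Real.log (q k i) - Real.log (z s k i)) * (q - x) k i
        ≤ G.pairing (G.response T (z s)) (q - x) - G.pairing q (q - x) := by
      simp only [sub_mul, Finset.sum_sub_distrib, mul_sub]
      have h2 := sum_mul_log_response (G := G) hT x hd
      rw [← hq] at h2
      linarith [hfirst s h0 (by linarith)]
    have hterm : ∀ k i, 0 ≤ (Real.log (q k i) - Real.log (z s k i)) * (q - x) k i := fun k i => by
      have h := log_segment_antitone ((hx k).1 i) (hq0 k i) h0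
        (by linarith : s ≤ 1) le_rfl
      simpa [hz] using h
    refine le_trans ?_ hsum
    calc T k₀ * ((Real.log (q k₀ i₀) - Real.log (z (1 / 2) k₀ i₀)) * (q k₀ i₀ - x k₀ i₀))
        ≤ T k₀ * ((Real.log (q k₀ i₀) - Real.log (z s k₀ i₀)) * (q - x) k₀ i₀) :=
          mul_le_mul_of_nonneg_left (log_segment_antitone ((hx k₀).1 i₀) (hq0 k₀ i₀) h0 h1
            (by norm_num)) (hT k₀).le
      _ ≤ T k₀ * ∑ i, (Real.log (q k₀ i) - Real.log (z s k₀ i)) * (q - x) k₀ i :=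
          mul_le_mul_of_nonneg_left (Finset.single_le_sum (fun i _ => hterm k₀ i)
            (Finset.mem_univ i₀)) (hT k₀).le
      _ ≤ _ := Finset.single_le_sum
          (f := fun k => T k * ∑ i, (Real.log (q k i) - Real.log (z s k i)) * (q - x) k i)
          (fun k _ => mul_nonneg (hT k).le (Finset.sum_nonneg fun i _ => hterm k i))
          (Finset.mem_univ k₀)
  have hlim : Tendsto (fun s => G.pairing (G.response T (z s)) (q - x) - G.pairing q (q - x))
      (𝓝[>] 0) (𝓝 0) := by
    have hc : Continuous fun s => G.pairing (G.response T (z s)) (q - x) - G.pairing q (q - x) := by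
      have h1 : Continuous fun s => G.response T (z s) :=
        (G.continuous_response T).comp (by fun_prop)
      simp only [pairing, dotProduct]
      fun_prop
    refine (hc.tendsto' 0 0 ?_).mono_left nhdsWithin_le_nhds
    simp [hz, hq]
  have hle := ge_of_tendsto hlim (by
    filter_upwards [Ioc_mem_nhdsGT (by norm_num : (0 : ℝ) < 1 / 2)] with s hs
    exact hup s hs.1 hs.2)
  have hz2 : z (1 / 2) k₀ i₀ ≠ q k₀ i₀ := fun h => hki <| by
    simp only [hz, Pi.add_apply, Pi.smul_apply, Pi.sub_apply, smul_eq_mul] at h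
    linarith
  have hpos := log_sub_log_mul_sub_pos (hz0 (1 / 2) (by norm_num) (by norm_num) k₀ i₀)
    (hq0 k₀ i₀) hz2
  have hhalf : q k₀ i₀ - z (1 / 2) k₀ i₀ = 1 / 2 * (q k₀ i₀ - x k₀ i₀) := by
    simp only [hz, Pi.add_apply, Pi.smul_apply, Pi.sub_apply, smul_eq_mul]; ring
  rw [hhalf] at hpos
  nlinarith [hT k₀]

end Existence

/-! ### Existence of trajectories -/

section Trajectories

theorem qldRate_eq (G : NetworkGame N S) (T : N → ℝ) {x : ∀ k, S k → ℝ}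
    (hx : x ∈ interiorStrategies S) (k : N) (i : S k) :
    G.qldRate T x k i = G.reward x k i - T k * Real.log (x k i)
      - ∑ j, x k j * (G.reward x k j - T k * Real.log (x k j)) := by
  have h : ∑ j, x k j * Real.log (x k j / x k i)
      = ∑ j, x k j * Real.log (x k j) - Real.log (x k i) := by
    simp only [Real.log_div (hx.2 k _).ne' (hx.2 k i).ne', mul_sub, Finset.sum_sub_distrib,
      ← Finset.sum_mul, (hx.1 k).2, one_mul]
  have h2 : ∑ j, x k j * (G.reward x k j - T k * Real.log (x k j))
      = x k ⬝ᵥ G.reward x k - T k * ∑ j, x k j * Real.log (x k j) := by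
    rw [dotProduct, Finset.mul_sum, ← Finset.sum_sub_distrib]
    exact Finset.sum_congr rfl fun j _ => by ring
  rw [qldRate, h, h2]
  ring

variable [∀ k, Nonempty (S k)]

/-- Writing a joint strategy as `x k = softmax (u k)` turns the Q-Learning dynamics into the
equation `u' = r (x) - T u` for the scores `u`; its right-hand side is smooth on the whole space
and has linear growth, so that its solutions exist for all times. -/
theorem exists_isQLDTrajectory (G : NetworkGame N S) (T : N → ℝ) {x₀ : ∀ k, S k → ℝ}
    (hx₀ : x₀ ∈ interiorStrategies S) :
    ∃ x : ℝ → ∀ k, S k → ℝ, G.IsQLDTrajectory T x ∧ x 0 = x₀ := by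
  set r : (∀ k, S k → ℝ) → ∀ k, S k → ℝ := fun u => G.reward fun k => softmax (u k) with hr
  set F : (∀ k, S k → ℝ) → ∀ k, S k → ℝ := fun u => r u - fun k => T k • u k with hF
  have hsm : ContDiff ℝ 1 fun (u : ∀ k, S k → ℝ) (k : N) => softmax (u k) :=
    contDiff_pi.2 fun k => contDiff_softmax.comp (contDiff_pi.1 contDiff_id k)
  have hFc : ContDiff ℝ 1 F := by
    refine contDiff_pi.2 fun k => contDiff_pi.2 fun i => ContDiff.sub ?_ ?_
    · exact (G.contDiff_reward k i).comp hsm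
    · exact contDiff_const.mul (contDiff_pi.1 (contDiff_pi.1 contDiff_id k) i)
  obtain ⟨R, hR⟩ : ∃ R, ∀ x ∈ strategies S, ‖G.reward x‖ ≤ R :=
    isCompact_strategies.exists_bound_of_continuousOn (f := fun x => G.reward x)
      (continuous_pi fun k => continuous_pi fun i => G.continuous_reward k i).continuousOn
  have hbound : ∀ u, ‖F u‖ ≤ R + ‖T‖ * ‖u‖ := fun u => by
    refine (norm_sub_le _ _).trans (add_le_add (hR _ (softmax_mem_interiorStrategies u).1) ?_)
    refine (pi_norm_le_iff_of_nonneg (by positivity)).2 fun k => ?_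
    rw [norm_smul]
    exact mul_le_mul (norm_le_pi_norm T k) (norm_le_pi_norm u k) (norm_nonneg _) (norm_nonneg _)
  obtain ⟨u, hu0, hu⟩ := exists_hasDerivAt_of_contDiff_of_norm_le hFc
    ((norm_nonneg _).trans (hR _ hx₀.1)) (norm_nonneg T) hbound fun k i => Real.log (x₀ k i)
  refine ⟨fun t k => softmax (u t k), fun t _ => ⟨softmax_mem_interiorStrategies (u t),
    fun k i => ?_⟩, ?_⟩
  · have h := (hasDerivAt_softmax_comp (hasDerivAt_pi.1 (hu t) k) i).hasDerivWithinAt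
      (s := Set.Ici 0)
    refine h.congr_deriv ?_
    rw [qldRate_eq G T (softmax_mem_interiorStrategies (u t))]
    simp only [log_softmax, hF, hr, Pi.sub_apply, Pi.smul_apply, smul_eq_mul]
    -- The normalising constant `logSumExp (u t k)` cancels since probabilities sum to `1`.
    have hc : ∑ j, softmax (u t k) j * (G.reward (fun k => softmax (u t k)) k j
          - T k * (u t k j - logSumExp (u t k)))
        = ∑ j, softmax (u t k) j * (G.reward (fun k => softmax (u t k)) k j - T k * u t k j)
          + T k * logSumExp (u t k) := by
      rw [← mul_one (T k * logSumExp (u t k)), ← sum_softmax (u t k), Finset.mul_sum,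
        ← Finset.sum_add_distrib]
      exact Finset.sum_congr rfl fun j _ => by ring
    rw [hc]
    ring
  · funext k
    simp only [hu0]
    exact softmax_log (hx₀.2 k) (hx₀.1 k).2

end Trajectories

/-! ### Convergence -/

section Convergence

/-- The relative entropy of `p` with respect to `x`, summed over the players. -/
noncomputable def relEntropy (p x : ∀ k, S k → ℝ) : ℝ :=
  ∑ k, ∑ i, p k i * (Real.log (p k i) - Real.log (x k i))

variable [∀ k, Nonempty (S k)]

theorem IsQRE.mem_interiorStrategies {G : NetworkGame N S} {T : N → ℝ} {p : ∀ k, S k → ℝ}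
    (hp : G.IsQRE T p) : p ∈ interiorStrategies S :=
  ⟨hp.1, fun k i => by rw [isQRE_iff.1 hp]; exact softmax_pos _ i⟩

/-- Along the Q-Learning dynamics, `relEntropy p` has the derivative `-∑ p * qldRate`. If `p` is an
equilibrium, this gives exponential decay, because the rewards drop out by skew-symmetry and the
entropy terms leave the symmetrised relative entropy of `p` and `x`. -/
theorem IsQRE.mul_relEntropy_le {G : NetworkGame N S} (hG : G.IsPairwiseZeroSum) {T : N → ℝ}
    (hT : ∀ k, 0 < T k) {c : ℝ} (hc : ∀ k, c ≤ T k) {p x : ∀ k, S k → ℝ} (hp : G.IsQRE T p)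
    (hx : x ∈ interiorStrategies S) :
    c * relEntropy p x ≤ ∑ k, ∑ i, p k i * G.qldRate T x k i := by
  have hpi := hp.mem_interiorStrategies
  have hd : ∀ k, ∑ i, (p - x) k i = 0 := fun k => by
    simp only [Pi.sub_apply, Finset.sum_sub_distrib, (hpi.1 k).2, (hx.1 k).2, sub_self]
  have hrate : ∑ k, ∑ i, p k i * G.qldRate T x k i
      = G.pairing (p - x) x - ∑ k, T k * ∑ i, Real.log (x k i) * (p - x) k i := by
    rw [pairing, ← Finset.sum_sub_distrib]
    refine Finset.sum_congr rfl fun k _ => ?_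
    simp only [qldRate_eq G T hx, mul_sub (p k _) (_ - _) _]
    rw [Finset.sum_sub_distrib, ← Finset.sum_mul, (hpi.1 k).2, one_mul, ← Finset.sum_sub_distrib,
      dotProduct, Finset.mul_sum, ← Finset.sum_sub_distrib]
    exact Finset.sum_congr rfl fun i _ => by simp only [Pi.sub_apply]; ring
  have hlog := sum_mul_log_response (G := G) hT p hd
  rw [← isQRE_iff.1 hp] at hlog
  have hskew : G.pairing (p - x) x = G.pairing (p - x) p := by
    have h := hG.pairing_self (p - x)
    rw [pairing_sub_right] at h
    linarith
  rw [hrate, hskew, ← hlog, ← Finset.sum_sub_distrib, relEntropy, Finset.mul_sum]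
  refine Finset.sum_le_sum fun k _ => ?_
  have hKL := sum_mul_log_sub_log_nonneg (hpi.2 k) (hx.2 k) ((hpi.1 k).2.trans (hx.1 k).2.symm)
  have hKL' := sum_mul_log_sub_log_nonneg (hx.2 k) (hpi.2 k) ((hx.1 k).2.trans (hpi.1 k).2.symm)
  have hsym : ∑ i, Real.log (p k i) * (p - x) k i - ∑ i, Real.log (x k i) * (p - x) k i
      = ∑ i, p k i * (Real.log (p k i) - Real.log (x k i))
        + ∑ i, x k i * (Real.log (x k i) - Real.log (p k i)) := by
    rw [← Finset.sum_sub_distrib, ← Finset.sum_add_distrib]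
    exact Finset.sum_congr rfl fun i _ => by simp only [Pi.sub_apply]; ring
  rw [← mul_sub, hsym]
  exact mul_le_mul (hc k) (by linarith) hKL (hT k).le

theorem IsQLDTrajectory.relEntropy_le {G : NetworkGame N S} (hG : G.IsPairwiseZeroSum)
    {T : N → ℝ} (hT : ∀ k, 0 < T k) {c : ℝ} (hc : ∀ k, c ≤ T k) {p : ∀ k, S k → ℝ}
    (hp : G.IsQRE T p) {x : ℝ → ∀ k, S k → ℝ} (hx : G.IsQLDTrajectory T x) {t : ℝ} (ht : 0 ≤ t) :
    relEntropy p (x t) ≤ relEntropy p (x 0) * Real.exp (-(c * t)) := by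
  have hV : ∀ s, 0 ≤ s → HasDerivWithinAt (fun s => relEntropy p (x s))
      (-∑ k, ∑ i, p k i * G.qldRate T (x s) k i) (Set.Ici 0) s := fun s hs => by
    rw [← Finset.sum_neg_distrib]
    refine HasDerivWithinAt.fun_sum fun k _ => ?_
    rw [← Finset.sum_neg_distrib]
    refine HasDerivWithinAt.fun_sum fun i _ => ?_
    have hpos := ((hx s hs).1.2 k i).ne'
    refine ((((hx s hs).2 k i).log hpos).const_sub _ |>.const_mul (p k i)).congr_deriv ?_
    field_simp
  have hW : ∀ s, 0 ≤ s → HasDerivWithinAt (fun s => Real.exp (c * s) * relEntropy p (x s))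
      (Real.exp (c * s) * (c * relEntropy p (x s) - ∑ k, ∑ i, p k i * G.qldRate T (x s) k i))
      (Set.Ici 0) s := fun s hs => by
    have he : HasDerivWithinAt (fun s => Real.exp (c * s)) (Real.exp (c * s) * c) (Set.Ici 0) s := by
      simpa using ((hasDerivAt_id s).const_mul c).exp.hasDerivWithinAt
    exact (he.mul (hV s hs)).congr_deriv (by ring)
  have hanti : AntitoneOn (fun s => Real.exp (c * s) * relEntropy p (x s)) (Set.Ici 0) := by
    refine antitoneOn_of_hasDerivWithinAt_nonpos (convex_Ici 0)
      (fun s hs => (hW s hs).continuousWithinAt)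
      (fun s hs => (hW s (interior_subset hs)).mono interior_subset) fun s hs => ?_
    have h := hp.mul_relEntropy_le hG hT hc (hx s (interior_subset hs)).1
    exact mul_nonpos_of_nonneg_of_nonpos (Real.exp_pos _).le (by linarith)
  have h := hanti (Set.mem_Ici.2 le_rfl) (Set.mem_Ici.2 ht) ht
  simp only [mul_zero, Real.exp_zero, one_mul] at h
  rw [Real.exp_neg, ← div_eq_mul_inv, le_div_iff₀ (Real.exp_pos _), mul_comm]
  exact h

theorem IsQLDTrajectory.tendsto {G : NetworkGame N S} (hG : G.IsPairwiseZeroSum)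
    {T : N → ℝ} (hT : ∀ k, 0 < T k) {p : ∀ k, S k → ℝ} (hp : G.IsQRE T p)
    {x : ℝ → ∀ k, S k → ℝ} (hx : G.IsQLDTrajectory T x) : Tendsto x atTop (𝓝 p) := by
  obtain ⟨c, hc0, hc⟩ : ∃ c : ℝ, 0 < c ∧ ∀ k, c ≤ T k := by
    have : ∀ᶠ c in 𝓝[>] (0 : ℝ), ∀ k, c ≤ T k := eventually_all.2 fun k => by
      filter_upwards [Ioc_mem_nhdsGT (hT k)] with c hc using hc.2
    exact (eventually_mem_nhdsWithin.and this).exists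
  have hlim : Tendsto (fun t => relEntropy p (x 0) * Real.exp (-(c * t))) atTop (𝓝 0) := by
    have h : Tendsto (fun t => Real.exp (-(c * t))) atTop (𝓝 0) :=
      Real.tendsto_exp_neg_atTop_nhds_zero.comp (tendsto_id.const_mul_atTop hc0)
    simpa using h.const_mul (relEntropy p (x 0))
  refine tendsto_pi_nhds.2 fun k => tendsto_pi_nhds.2 fun i => ?_
  have hsq : Tendsto (fun t => (√(x t k i) - √(p k i)) ^ 2) atTop (𝓝 0) := by
    refine squeeze_zero' (Eventually.of_forall fun t => sq_nonneg _) ?_ hlim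
    filter_upwards [eventually_ge_atTop 0] with t ht
    refine le_trans ?_ (hx.relEntropy_le hG hT hc hp ht)
    have hpi := hp.mem_interiorStrategies
    have hxi := (hx t ht).1
    calc (√(x t k i) - √(p k i)) ^ 2 = (√(p k i) - √(x t k i)) ^ 2 := by ring
      _ ≤ ∑ i, (√(p k i) - √(x t k i)) ^ 2 :=
          Finset.single_le_sum (f := fun i => (√(p k i) - √(x t k i)) ^ 2)
            (fun _ _ => sq_nonneg _) (Finset.mem_univ i)
      _ ≤ ∑ i, p k i * (Real.log (p k i) - Real.log (x t k i)) :=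
          sum_sqrt_sub_sqrt_sq_le (hpi.2 k) (hxi.2 k) ((hpi.1 k).2.trans (hxi.1 k).2.symm)
      _ ≤ relEntropy p (x t) :=
          Finset.single_le_sum
            (f := fun k => ∑ i, p k i * (Real.log (p k i) - Real.log (x t k i)))
            (fun k _ => sum_mul_log_sub_log_nonneg (hpi.2 k) (hxi.2 k)
              ((hpi.1 k).2.trans (hxi.1 k).2.symm)) (Finset.mem_univ k)
  have hsub : Tendsto (fun t => √(x t k i) - √(p k i)) atTop (𝓝 0) := by
    have h := hsq.sqrt
    simp only [Real.sqrt_sq_eq_abs, Real.sqrt_zero] at h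
    exact (tendsto_zero_iff_abs_tendsto_zero _).2 h
  have hsqrt : Tendsto (fun t => √(x t k i)) atTop (𝓝 √(p k i)) := by
    simpa using hsub.add_const √(p k i)
  have h2 := hsqrt.pow 2
  rw [Real.sq_sqrt (hp.1 k |>.1 i)] at h2
  refine h2.congr' ?_
  filter_upwards [eventually_ge_atTop 0] with t ht
  exact Real.sq_sqrt ((hx t ht).1.2 k i).le

theorem IsQRE.isQLDTrajectory_const {G : NetworkGame N S} {T : N → ℝ} (hT : ∀ k, 0 < T k)
    {p : ∀ k, S k → ℝ} (hp : G.IsQRE T p) : G.IsQLDTrajectory T fun _ => p := by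
  refine fun t _ => ⟨hp.mem_interiorStrategies, fun k i => ?_⟩
  -- At an equilibrium, `r k i - T k * log (p k i)` does not depend on `i`.
  have hconst : ∀ j, G.reward p k j - T k * Real.log (p k j)
      = T k * logSumExp fun i => G.reward p k i / T k := fun j => by
    have h : Real.log (p k j)
        = G.reward p k j / T k - logSumExp fun i => G.reward p k i / T k := by
      conv_lhs => rw [isQRE_iff.1 hp]
      exact log_softmax _ j
    have := (hT k).ne'
    rw [h]
    field_simp
    ring
  have hrate : G.qldRate T p k i = 0 := by
    rw [qldRate_eq G T hp.mem_interiorStrategies]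
    simp only [hconst, ← Finset.sum_mul, (hp.1 k).2, one_mul, sub_self]
  rw [hrate, mul_zero]
  exact hasDerivWithinAt_const _ _ _

end Convergence

end NetworkGame

theorem corollary1 {N : Type*} [Fintype N] {S : N → Type*} [∀ k, Fintype (S k)]
    [∀ k, Nonempty (S k)] (G : NetworkGame N S) (hG : G.IsPairwiseZeroSum)
    (T : N → ℝ) (hT : ∀ k, 0 < T k) :
    ∃ xbar : ∀ k, S k → ℝ,
      G.IsQRE T xbar ∧ (∀ y, G.IsQRE T y → y = xbar) ∧
      (∀ x₀ ∈ NetworkGame.interiorStrategies S,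
        ∃ x : ℝ → ∀ k, S k → ℝ, G.IsQLDTrajectory T x ∧ x 0 = x₀) ∧
      ∀ x : ℝ → ∀ k, S k → ℝ, G.IsQLDTrajectory T x → Tendsto x atTop (𝓝 xbar) := by
  obtain ⟨p, hp⟩ := hG.exists_isQRE hT
  refine ⟨p, hp, fun y hy => ?_, fun x₀ hx₀ => G.exists_isQLDTrajectory T hx₀,
    fun x hx => hx.tendsto hG hT hp⟩
  -- Another equilibrium is a constant trajectory, and it converges to `p`.
  exact tendsto_nhds_unique tendsto_const_nhds ((hy.isQLDTrajectory_const hT).tendsto hG hT hp)
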